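/- Let $\mathbb{F}_q$ be a finite field with $q$ elements, let $K$ be an algebraically closed field containing $\mathbb{F}_q$, let $A=\mathbb{F}_q[T]$ and let $\delta:A\to K$ be a homomorphism of $\mathbb{F}_q$-algebras. Let $\Lambda_N\subset K[X_1,\dots,X_N]$ be the set of $K$-linear combinations of the monomials $X_i^{q^j}$ ($1\le i\le N$, $j\ge 0$). A $q$-variety in $K^N$ is the set $F\subset K^N$ of common zeros of some subset of $\Lambda_N$; it is an $\mathbb{F}_q$-subspace of $K^N$. It is irreducible if the only $q$-variety $H\subset F$ with $F/H$ finite is $F$ itself. $\mathrm{End}(F)$ denotes the $\mathbb{F}_q$-algebra, under pointwise addition and composition, of the maps $\psi:F\to F$ of the form $\psi(x)=(f_1(x),\dots,f_N(x))$ with $f_1,\dots,f_N\in\Lambda_N$. Writing $d(f)$ for the linear part of $f\in\Lambda_N$, the tangent space of $F$ is $T(F)=\{x\in K^N : d(f)(x)=0 \text{ for all } f\in\Lambda_N \text{ vanishing on } F\}$, and the differential of $\psi$ is the ($K$-linear, well-defined) map $d(\psi):T(F)\to T(F)$, $x\mapsto (d(f_1)(x),\dots,d(f_N)(x))$. An $A$-module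 $(F,\Phi)$ is a $q$-variety $F$ together with a homomorphism of $\mathbb{F}_q$-algebras $\Phi:A\to\mathrm{End}(F)$, $a\mapsto\Phi_a$, such that $d(\Phi_a)=\delta(a)\,\mathrm{Id}_{T(F)}$ for all $a\in A$; it is irreducible if the $q$-variety $F$ is. For $a\in A$ put $\mathrm{Tor}(a,F)=\{x\in F : \Phi_a(x)=0\}$, an $A$-module through $\Phi$. **Theorem.** Let $(F,\Phi)$ be an irreducible $A$-module and let $\pi\in A\setminus\ker\delta$ be a prime. Then there exists $r\in\mathbb{N}$ such that for all $n>0$ there is an isomorphism of $A$-modules $$\mathrm{Tor}(\pi^n,F)\cong (A/\pi^nA)^r .$$ -/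

import Mathlib

namespace QVar

open MvPolynomial

set_option linter.unusedSectionVars false

variable (Fq : Type*) [Field Fq] [Finite Fq]

/-- On a commutative `Fq`-algebra `R`, with `q = #Fq`, the map `x ↦ x ^ (q ^ j)` is a
homomorphism of `Fq`-algebras. -/
theorem exists_powHom (R : Type*) [CommRing R] [Algebra Fq R] (j : ℕ) :
    ∃ φ : R →ₐ[Fq] R, ∀ x, φ x = x ^ (Nat.card Fq ^ j) := by
  have := Fintype.ofFinite Fq
  induction j with
  | zero => exact ⟨AlgHom.id Fq R, fun x => by simp⟩
  | succ j ih =>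
    obtain ⟨φ, hφ⟩ := ih
    refine ⟨(FiniteField.frobeniusAlgHom Fq R).comp φ, fun x => ?_⟩
    simp [hφ, Nat.card_eq_fintype_card, pow_succ, pow_mul]

variable (K : Type*) [Field K] [Algebra Fq K]

/-- `Λₙ = K{τ₁} ⊕ ⋯ ⊕ K{τₙ}`: the polynomials in `X₁, …, Xₙ` over `K` that are `K`-linear
combinations of the monomials `Xᵢ ^ (q ^ j)`, where `q = #Fq`. -/
noncomputable def Lam (n : ℕ) : Submodule K (MvPolynomial (Fin n) K) :=
  Submodule.span K (Set.range fun ij : Fin n × ℕ => X ij.1 ^ (Nat.card Fq ^ ij.2))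

variable {Fq K}

theorem eval_add_of_mem {n : ℕ} {f : MvPolynomial (Fin n) K} (hf : f ∈ Lam Fq K n)
    (x y : Fin n → K) : eval (x + y) f = eval x f + eval y f := by
  induction hf using Submodule.span_induction with
  | mem f hf =>
    obtain ⟨⟨i, j⟩, rfl⟩ := hf
    obtain ⟨φ, hφ⟩ := exists_powHom Fq K j
    simp [← hφ]
  | zero => simp
  | add f g _ _ hf hg => simp only [map_add, hf, hg]; ring
  | smul c f _ hf => simp only [smul_eval, hf]; ring

theorem eval_smul_of_mem {n : ℕ} {f : MvPolynomial (Fin n) K} (hf : f ∈ Lam Fq K n)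
    (c : Fq) (x : Fin n → K) : eval (c • x) f = c • eval x f := by
  induction hf using Submodule.span_induction with
  | mem f hf =>
    obtain ⟨⟨i, j⟩, rfl⟩ := hf
    obtain ⟨φ, hφ⟩ := exists_powHom Fq K j
    simp [← hφ]
  | zero => simp
  | add f g _ _ hf hg => simp only [map_add, hf, hg, smul_add]
  | smul c f _ hf => simp only [smul_eval, hf, mul_smul_comm]

/-- `Z(S)`: the common zeros in `Kⁿ` of a set `S ⊆ Λₙ`, as an `Fq`-subspace of `Kⁿ`. -/
noncomputable def Z {n : ℕ} (S : Set (Lam Fq K n)) : Submodule Fq (Fin n → K) where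
  carrier := {x | ∀ f ∈ S, eval x (f : MvPolynomial (Fin n) K) = 0}
  zero_mem' f _ := by
    have h := eval_smul_of_mem f.2 (0 : Fq) 0
    rwa [zero_smul, zero_smul] at h
  add_mem' {x y} hx hy f hf := by rw [eval_add_of_mem f.2, hx f hf, hy f hf, add_zero]
  smul_mem' c x hx f hf := by rw [eval_smul_of_mem f.2, hx f hf, smul_zero]

/-- A `q`-variety in `Kⁿ` is a set of the form `Z(S)` with `S ⊆ Λₙ`. -/
def IsQVariety {n : ℕ} (F : Submodule Fq (Fin n → K)) : Prop :=
  ∃ S : Set (Lam Fq K n), F = Z S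

/-- `F` is irreducible if its only sub-`q`-variety of finite index is `F` itself. -/
def IsIrreducible {n : ℕ} (F : Submodule Fq (Fin n → K)) : Prop :=
  ∀ H : Submodule Fq (Fin n → K), IsQVariety H → H ≤ F →
    Finite (F ⧸ H.submoduleOf F) → H = F

/-- `M(F)`: the elements of `Λₙ` that vanish on `F`. -/
def M {n : ℕ} (F : Submodule Fq (Fin n → K)) : Set (Lam Fq K n) :=
  {f | ∀ x ∈ F, eval x (f : MvPolynomial (Fin n) K) = 0}

/-- The linear part `d(f) = ∑ᵢ aᵢ Xᵢ` of a polynomial `f`, as a linear form on `Kⁿ`; here `aᵢ` is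
the coefficient of `Xᵢ` in `f`. -/
noncomputable def linPart {n : ℕ} (f : MvPolynomial (Fin n) K) : (Fin n → K) →ₗ[K] K :=
  ∑ i, coeff (Finsupp.single i 1) f • LinearMap.proj i

theorem linPart_apply {n : ℕ} (f : MvPolynomial (Fin n) K) (x : Fin n → K) :
    linPart f x = ∑ i, coeff (Finsupp.single i 1) f * x i := by
  simp [linPart]

theorem linPart_add {n : ℕ} (f g : MvPolynomial (Fin n) K) :
    linPart (f + g) = linPart f + linPart g := by
  simp [linPart, add_smul, Finset.sum_add_distrib]

theorem linPart_smul {n : ℕ} (c : K) (f : MvPolynomial (Fin n) K) :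
    linPart (c • f) = c • linPart f := by
  simp [linPart, mul_smul, Finset.smul_sum]

theorem linPart_zero {n : ℕ} : linPart (0 : MvPolynomial (Fin n) K) = 0 := by
  simp [linPart]

theorem linPart_X {n : ℕ} (i : Fin n) (x : Fin n → K) :
    linPart (X i : MvPolynomial (Fin n) K) x = x i := by
  classical
  simp [linPart_apply, coeff_X, Finsupp.single_left_inj]

variable (Fq) in
theorem linPart_X_pow {n : ℕ} (c : K) (i : Fin n) {j : ℕ} (hj : j ≠ 0) :
    linPart (c • X i ^ (Nat.card Fq ^ j) : MvPolynomial (Fin n) K) = 0 := by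
  classical
  have h1 : Nat.card Fq ^ j ≠ 1 := by
    have := Nat.one_lt_pow hj (Finite.one_lt_card (α := Fq))
    omega
  have : linPart (X i ^ (Nat.card Fq ^ j) : MvPolynomial (Fin n) K) = 0 := by
    rw [linPart]
    refine Finset.sum_eq_zero fun l _ => ?_
    rw [coeff_X_pow, if_neg, zero_smul]
    intro h
    have := congrArg Finsupp.degree h
    simp only [Finsupp.degree_single] at this
    exact h1 this
  rw [linPart_smul, this, smul_zero]

/-- Composition of an element of `Λₙ` with `τ ^ j`. -/
theorem pow_mem {n : ℕ} {f : MvPolynomial (Fin n) K} (hf : f ∈ Lam Fq K n) (j : ℕ) :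
    f ^ (Nat.card Fq ^ j) ∈ Lam Fq K n ∧ (j ≠ 0 → linPart (f ^ (Nat.card Fq ^ j)) = 0) := by
  obtain ⟨φ, hφ⟩ := exists_powHom Fq (MvPolynomial (Fin n) K) j
  induction hf using Submodule.span_induction with
  | mem f hf =>
    obtain ⟨⟨i, k⟩, rfl⟩ := hf
    simp only [← pow_mul, ← pow_add]
    refine ⟨Submodule.subset_span ⟨(i, k + j), rfl⟩, fun hj => ?_⟩
    have := linPart_X_pow Fq (1 : K) i (j := k + j) (by omega)
    rwa [one_smul] at this
  | zero => rw [← hφ, map_zero]; exact ⟨zero_mem _, fun _ => linPart_zero⟩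
  | add f g _ _ hf hg =>
    rw [← hφ] at hf hg ⊢
    rw [map_add]
    exact ⟨add_mem hf.1 hg.1, fun hj => by rw [linPart_add, hf.2 hj, hg.2 hj, add_zero]⟩
  | smul c f _ hf =>
    rw [smul_pow]
    exact ⟨Submodule.smul_mem _ _ hf.1, fun hj => by rw [linPart_smul, hf.2 hj, smul_zero]⟩

/-- The composite `g(f₁, …, fₘ)` lies in `Λₙ`, and the chain rule holds. -/
theorem bind_mem {n m : ℕ} {g : MvPolynomial (Fin m) K} (hg : g ∈ Lam Fq K m)
    (f : Fin m → Lam Fq K n) :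
    bind₁ (fun i => (f i : MvPolynomial (Fin n) K)) g ∈ Lam Fq K n ∧
      ∀ x, linPart (bind₁ (fun i => (f i : MvPolynomial (Fin n) K)) g) x =
        linPart g (fun i => linPart (f i : MvPolynomial (Fin n) K) x) := by
  induction hg using Submodule.span_induction with
  | mem g hg =>
    obtain ⟨⟨i, j⟩, rfl⟩ := hg
    simp only [map_pow, bind₁_X_right]
    refine ⟨(pow_mem (f i).2 j).1, fun x => ?_⟩
    rcases eq_or_ne j 0 with rfl | hj
    · simp [linPart_X]
    · have := linPart_X_pow Fq (1 : K) i hj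
      rw [one_smul] at this
      rw [(pow_mem (f i).2 j).2 hj, this]; rfl
  | zero => simp [linPart_zero]
  | add g h _ _ hg hh =>
    rw [map_add]
    exact ⟨add_mem hg.1 hh.1, fun x => by simp [linPart_add, hg.2, hh.2]⟩
  | smul c g _ hg =>
    rw [map_smul]
    exact ⟨Submodule.smul_mem _ _ hg.1, fun x => by simp [linPart_smul, hg.2]⟩

theorem eval_bind {n m : ℕ} (g : MvPolynomial (Fin m) K) (f : Fin m → MvPolynomial (Fin n) K)
    (x : Fin n → K) : eval x (bind₁ f g) = eval (fun i => eval x (f i)) g := by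
  have := eval₂Hom_bind₁ (RingHom.id K) x f g
  exact this

/-- The tuple `(f₁, …, fₘ)` of elements of `Λₙ` induces the map `ψ : F → H`. -/
def Represents {n m : ℕ} {F : Submodule Fq (Fin n → K)} {H : Submodule Fq (Fin m → K)}
    (f : Fin m → Lam Fq K n) (ψ : F → H) : Prop :=
  ∀ (x : F) (i : Fin m), (ψ x : Fin m → K) i = eval (x : Fin n → K) (f i : MvPolynomial (Fin n) K)

/-- A map `ψ : F → H` is a morphism if it is given by elements `f₁, …, fₘ` of `Λₙ`. -/
def IsMorphism {n m : ℕ} {F : Submodule Fq (Fin n → K)} {H : Submodule Fq (Fin m → K)}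
    (ψ : F → H) : Prop :=
  ∃ f : Fin m → Lam Fq K n, Represents f ψ

/-- Morphisms are automatically `Fq`-linear. -/
theorem IsMorphism.isLinearMap {n m : ℕ} {F : Submodule Fq (Fin n → K)}
    {H : Submodule Fq (Fin m → K)} {ψ : F → H} (hψ : IsMorphism ψ) : IsLinearMap Fq ψ := by
  obtain ⟨f, hf⟩ := hψ
  constructor
  · intro x y
    ext i
    simp [hf _ i, eval_add_of_mem (f i).2]
  · intro c x
    ext i
    simp [hf _ i, eval_smul_of_mem (f i).2]

/-- `End(F) = Mor(F, F)`, with pointwise addition and with composition as multiplication. -/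
noncomputable def QEnd {n : ℕ} (F : Submodule Fq (Fin n → K)) :
    Subalgebra Fq (Module.End Fq F) where
  carrier := {ψ | IsMorphism ψ}
  mul_mem' := by
    rintro ψ χ ⟨f, hf⟩ ⟨g, hg⟩
    refine ⟨fun i => ⟨bind₁ (fun j => (g j : MvPolynomial (Fin n) K)) (f i),
      (bind_mem (f i).2 g).1⟩, fun x i => ?_⟩
    rw [Module.End.mul_apply, hf, eval_bind]
    congr 2
    ext j
    rw [hg]
  add_mem' := by
    rintro ψ χ ⟨f, hf⟩ ⟨g, hg⟩
    exact ⟨fun i => f i + g i, fun x i => by simp [hf x i, hg x i]⟩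
  algebraMap_mem' c := by
    refine ⟨fun i => ⟨algebraMap Fq K c • X i,
      Submodule.smul_mem _ _ (Submodule.subset_span ⟨(i, 0), by simp⟩)⟩, fun x i => ?_⟩
    simp [Module.algebraMap_end_apply, Algebra.smul_def]

/-- The tangent space `T(F) = ⋂_{f ∈ M(F)} ker d(f)`. -/
noncomputable def T {n : ℕ} (F : Submodule Fq (Fin n → K)) : Submodule K (Fin n → K) :=
  ⨅ f ∈ M F, LinearMap.ker (linPart (f : MvPolynomial (Fin n) K))

theorem mem_T {n : ℕ} {F : Submodule Fq (Fin n → K)} {x : Fin n → K} :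
    x ∈ T F ↔ ∀ f ∈ M F, linPart (f : MvPolynomial (Fin n) K) x = 0 := by
  simp only [T, Submodule.mem_iInf, LinearMap.mem_ker]

theorem linPart_mem_T {n m : ℕ} {F : Submodule Fq (Fin n → K)} {H : Submodule Fq (Fin m → K)}
    {ψ : F → H} {f : Fin m → Lam Fq K n} (hf : Represents f ψ) {x : Fin n → K} (hx : x ∈ T F) :
    (fun i => linPart (f i : MvPolynomial (Fin n) K) x) ∈ T H := by
  rw [mem_T] at hx ⊢
  intro g hg
  rw [← (bind_mem g.2 f).2 x]
  refine hx ⟨_, (bind_mem g.2 f).1⟩ fun y hy => ?_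
  have : (fun i => eval y (f i : MvPolynomial (Fin n) K)) = ψ ⟨y, hy⟩ := by
    ext i
    rw [hf]
  rw [eval_bind, this]
  exact hg _ (ψ ⟨y, hy⟩).2

/-- The differential `d(ψ) : T(F) → T(H)`, `x ↦ (d(f₁)(x), …, d(fₘ)(x))`, of a morphism `ψ`
given by `f₁, …, fₘ`; see `differential_apply` for the independence of the choice. -/
noncomputable def differential {n m : ℕ} {F : Submodule Fq (Fin n → K)}
    {H : Submodule Fq (Fin m → K)} (ψ : F → H) (hψ : IsMorphism ψ) : T F →ₗ[K] T H :=
  LinearMap.codRestrict (T H)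
    (LinearMap.pi fun i =>
      (linPart (hψ.choose i : MvPolynomial (Fin n) K)).comp (T F).subtype)
    fun x => linPart_mem_T hψ.choose_spec x.2

theorem differential_apply {n m : ℕ} {F : Submodule Fq (Fin n → K)}
    {H : Submodule Fq (Fin m → K)} {ψ : F → H} (hψ : IsMorphism ψ) {f : Fin m → Lam Fq K n}
    (hf : Represents f ψ) (x : T F) (i : Fin m) :
    (differential ψ hψ x : Fin m → K) i =
      linPart (f i : MvPolynomial (Fin n) K) (x : Fin n → K) := by
  have key := mem_T.1 x.2 (hψ.choose i - f i) fun y hy => by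
    have h1 := hψ.choose_spec ⟨y, hy⟩ i
    have h2 := hf ⟨y, hy⟩ i
    simp only [AddSubgroupClass.coe_sub, map_sub]
    rw [← h1, ← h2, sub_self]
  have h3 : ((hψ.choose i - f i : Lam Fq K n) : MvPolynomial (Fin n) K) =
      (hψ.choose i : MvPolynomial (Fin n) K) + (-1 : K) • (f i : MvPolynomial (Fin n) K) := by
    simp [sub_eq_add_neg]
  rw [h3, linPart_add, linPart_smul] at key
  simp only [LinearMap.add_apply, LinearMap.smul_apply, smul_eq_mul] at key
  change linPart (hψ.choose i : MvPolynomial (Fin n) K) (x : Fin n → K) = _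
  linear_combination key

/-- An `A`-module structure on `F`, where `A = Fq[T]` and `δ : A → K`: a homomorphism of
`Fq`-algebras `Φ : A → End(F)` with `d(Φ_a) = δ(a) Id` on `T(F)` for all `a ∈ A`. -/
structure AModule (δ : Polynomial Fq →ₐ[Fq] K) {n : ℕ} (F : Submodule Fq (Fin n → K)) where
  /-- The homomorphism `Φ`. -/
  hom : Polynomial Fq →ₐ[Fq] QEnd F
  differential_hom : ∀ a : Polynomial Fq,
    differential (hom a : Module.End Fq F) (hom a).2 = δ a • LinearMap.id

namespace AModule

variable {δ : Polynomial Fq →ₐ[Fq] K} {n : ℕ} {F : Submodule Fq (Fin n → K)}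

/-- The group `F` itself, regarded as a module over `A = Fq[T]` through `Φ`. -/
def Carrier (_Φ : AModule δ F) : Type _ := F

noncomputable instance (Φ : AModule δ F) : AddCommGroup Φ.Carrier :=
  inferInstanceAs (AddCommGroup F)

noncomputable instance (Φ : AModule δ F) : Module (Polynomial Fq) Φ.Carrier :=
  Module.compHom F ((QEnd F).val.comp Φ.hom).toRingHom

theorem smul_def (Φ : AModule δ F) (a : Polynomial Fq) (x : F) :
    (a • (show Φ.Carrier from x) : Φ.Carrier) = (Φ.hom a : Module.End Fq F) x := rfl

/-- `Tor(a, F) = {x ∈ F | Φ_a(x) = 0}`, as an `A`-submodule of `F`. -/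
noncomputable def Tor (Φ : AModule δ F) (a : Polynomial Fq) : Submodule (Polynomial Fq) Φ.Carrier :=
  Submodule.torsionBy (Polynomial Fq) Φ.Carrier a

theorem mem_Tor (Φ : AModule δ F) (a : Polynomial Fq) (x : F) :
    (show Φ.Carrier from x) ∈ Φ.Tor a ↔ (Φ.hom a : Module.End Fq F) x = 0 := Iff.rfl

end AModule

end QVar

/-!
Let `ψ = Φ_π` and `c = δ(π) ≠ 0`, so that the differential of `ψ` is multiplication by `c`. It is
enough to show that `ψ` has finite kernel and is surjective: if `V` is a module over a ring `A`, if
`π` generates a maximal ideal of `A`, and if multiplication by `π` on `V` is surjective with finite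
kernel, then `V[π ^ n]` is free over `A / π ^ n` of rank `dim V[π]`, a basis being given by
`π ^ (n - 1)`-th parts of the elements of a basis of `V[π]` (`nonempty_torsionBy_pow_equiv`).

Finiteness is an étale statement: the common zeros in `K ^ n` of polynomials `hᵢ ∈ Λₙ` with linear
part `Xᵢ` are finite in number, since `K[X] / (h)` is unramified, hence finite, over `K`
(`finite_setOf_eval_eq_zero`). As `dψ = c`, such polynomials vanish on the kernel of `ψ`
(`finite_ker_of_linPart_eq_smul`).

For surjectivity, let `P = Mor(F, K)` be the left module over `K{τ}` of the restrictions to `F` of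
the elements of `Λₙ`. The ring `K{τ}` has principal left ideals, so `P` is noetherian and, as `K` is
algebraically closed, `K` is an injective `K{τ}`-module (`baer_skew`). The points of the `q`-variety
`F` are the `K{τ}`-linear maps `P → K` (`apply_eval_coordModule`), so `ψ` is surjective as soon as
the pullback `ψ^* : P → P` is injective. Its kernel `L` satisfies `L = τ L`: an `f ∈ L` has linear
part zero on the tangent space, because `c ≠ 0`, so it is a `q`-th power on `F`
(`exists_eq_pow_of_comp_eq_zero`). Finitely many generators of `L` therefore satisfy an étale system
of equations and take finitely many values on `F`, so the zero set of `L` has finite index in `F`;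
by irreducibility it is `F`, and `L = 0` (`eq_zero_of_forall_exists_pow`).
-/

namespace QVar

/-! ### Torsion of a divisible module -/

/-- If multiplication by `π` is surjective on `V` with finite kernel, and `π` generates a maximal
ideal, then the `π ^ n`-torsion of `V` is free over `A / π ^ n`, of a rank independent of `n`. -/
theorem nonempty_torsionBy_pow_equiv {A V : Type*} [CommRing A] [AddCommGroup V] [Module A V]
    {π : A} [hmax : (Ideal.span {π}).IsMaximal] (hsurj : ∀ x : V, ∃ y, π • y = x)
    (hfin : Finite (Submodule.torsionBy A V π)) :
    ∃ r : ℕ, ∀ n : ℕ, 0 < n →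
      Nonempty (Submodule.torsionBy A V (π ^ n) ≃ₗ[A] (Fin r → A ⧸ Ideal.span {π ^ n})) := by
  let _ : Field (A ⧸ Ideal.span {π}) := Ideal.Quotient.field _
  obtain ⟨r, ⟨b⟩⟩ : ∃ r, Nonempty (Module.Basis (Fin r) (A ⧸ Ideal.span {π})
      (Submodule.torsionBy A V π)) := ⟨_, ⟨Module.finBasis _ _⟩⟩
  -- the basis property of `b`, in terms of coefficients in `A`
  have hspan : ∀ x : V, π • x = 0 → ∃ c : Fin r → A, x = ∑ i, c i • (b i : V) := by
    intro x hx
    have h1 := b.sum_repr ⟨x, hx⟩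
    choose c hc using fun i => Ideal.Quotient.mk_surjective (b.repr ⟨x, hx⟩ i)
    refine ⟨c, ?_⟩
    have h2 := congrArg Subtype.val h1
    simp only [← hc] at h2
    rw [← h2, AddSubmonoidClass.coe_finsetSum]
    rfl
  have hind : ∀ c : Fin r → A, ∑ i, c i • (b i : V) = 0 → ∀ i, π ∣ c i := by
    intro c hc i
    have h1 : ∑ i, (Ideal.Quotient.mk (Ideal.span {π}) (c i)) • b i = 0 := by
      apply Subtype.ext
      rw [AddSubmonoidClass.coe_finsetSum]
      exact hc
    have := Fintype.linearIndependent_iff.1 b.linearIndependent _ h1 i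
    rwa [Ideal.Quotient.eq_zero_iff_mem, Ideal.mem_span_singleton] at this
  refine ⟨r, fun n hn => ?_⟩
  have hdiv : ∀ (m : ℕ) (x : V), ∃ y, π ^ m • y = x := by
    intro m
    induction m with
    | zero => exact fun x => ⟨x, by simp⟩
    | succ m ih =>
      intro x
      obtain ⟨y, rfl⟩ := ih x
      obtain ⟨z, rfl⟩ := hsurj y
      exact ⟨z, by rw [pow_succ, mul_smul]⟩
  -- the future basis of the `π ^ n`-torsion lifts `b` along multiplication by `π ^ (n - 1)`
  choose e he using fun i => hdiv (n - 1) (b i : V)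
  have heq : ∀ (j : ℕ) (c : Fin r → A), j < n →
      π ^ (n - 1 - j) • ∑ i, (π ^ j * c i) • e i = ∑ i, c i • (b i : V) := by
    intro j c hj
    rw [Finset.smul_sum]
    refine Finset.sum_congr rfl fun i _ => ?_
    rw [← he i, smul_smul, smul_smul, ← mul_assoc, ← pow_add, mul_comm,
      show n - 1 - j + j = n - 1 by omega]
  have hbt : ∀ i, π • (b i : V) = 0 := fun i => (b i).2
  have het : ∀ i, π ^ n • e i = 0 := by
    intro i
    rw [← hbt i, ← he i, smul_smul, ← pow_succ', Nat.sub_add_cancel hn]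
  let g : (Fin r → A) →ₗ[A] Submodule.torsionBy A V (π ^ n) :=
    Fintype.linearCombination A fun i => ⟨e i, het i⟩
  have hg : ∀ c, (g c : V) = ∑ i, c i • e i := by
    intro c
    simp [g, Fintype.linearCombination_apply]
  -- relations among the `e i` are detected one power of `π` at a time
  have hinj : ∀ c : Fin r → A, ∑ i, c i • e i = 0 → ∀ i, π ^ n ∣ c i := by
    intro c hc
    have key : ∀ j ≤ n, ∀ i, π ^ j ∣ c i := by
      intro j
      induction j with
      | zero => simp
      | succ j ih =>
        intro hj
        choose d hd using ih (by omega)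
        have h1 := heq j d (by omega)
        simp only [← hd, hc, smul_zero] at h1
        intro i
        rw [hd i, pow_succ]
        exact mul_dvd_mul_left _ (hind d h1.symm i)
    exact key n le_rfl
  -- the `e i` generate the `π ^ j`-torsion, by successive approximation
  have hsur : ∀ j ≤ n, ∀ x : V, π ^ j • x = 0 → ∃ c : Fin r → A, x = ∑ i, c i • e i := by
    intro j
    induction j with
    | zero => exact fun _ x hx => ⟨0, by simpa using hx⟩
    | succ j ih =>
      intro hj x hx
      obtain ⟨c, hc⟩ := hspan (π ^ j • x) (by rw [smul_smul, ← pow_succ', hx])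
      have h1 : π ^ j • (x - ∑ i, (π ^ (n - 1 - j) * c i) • e i) = 0 := by
        rw [smul_sub, hc, ← heq (n - 1 - j) c (by omega),
          show n - 1 - (n - 1 - j) = j by omega, sub_self]
      obtain ⟨d, hd⟩ := ih (by omega) _ h1
      refine ⟨fun i => d i + π ^ (n - 1 - j) * c i, ?_⟩
      simp only [add_smul, Finset.sum_add_distrib, ← hd, sub_add_cancel]
  have hgs : Function.Surjective g := by
    intro x
    obtain ⟨c, hc⟩ := hsur n le_rfl x x.2
    exact ⟨c, Subtype.ext (by rw [hg, hc])⟩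
  have hker : ∀ c, g c = 0 ↔ ∀ i, π ^ n ∣ c i := by
    intro c
    rw [← Subtype.coe_inj, hg, Submodule.coe_zero]
    refine ⟨hinj c, fun h => Finset.sum_eq_zero fun i _ => ?_⟩
    obtain ⟨d, hd⟩ := h i
    rw [hd, mul_comm, mul_smul, het, smul_zero]
  let q : (Fin r → A) →ₗ[A] (Fin r → A ⧸ Ideal.span {π ^ n}) :=
    LinearMap.pi fun i => (Ideal.span {π ^ n}).mkQ.comp (LinearMap.proj i)
  have hqs : Function.Surjective q := by
    intro y
    choose c hc using fun i => Ideal.Quotient.mk_surjective (y i)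
    exact ⟨c, funext hc⟩
  have hkq : LinearMap.ker g = LinearMap.ker q := by
    ext c
    rw [LinearMap.mem_ker, hker, LinearMap.mem_ker, funext_iff]
    refine forall_congr' fun i => ?_
    rw [← Ideal.mem_span_singleton]
    exact Ideal.Quotient.eq_zero_iff_mem.symm
  exact ⟨(g.quotKerEquivOfSurjective hgs).symm.trans
    ((Submodule.quotEquivOfEq _ _ hkq).trans (q.quotKerEquivOfSurjective hqs))⟩

/-! ### Étale systems of additive equations -/

section Etale

open MvPolynomial

variable {Fq : Type*} [Field Fq] [Finite Fq] {K : Type*} [Field K] [Algebra Fq K]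

variable (Fq K) in
theorem card_cast_eq_zero : (Nat.card Fq : K) = 0 := by
  have := Fintype.ofFinite Fq
  have h := congrArg (algebraMap Fq K) (FiniteField.cast_card_eq_zero Fq)
  rwa [map_natCast, map_zero, ← Nat.card_eq_fintype_card] at h

/-- In characteristic `p` a derivation kills `Xᵢ ^ (q ^ j)` for `j > 0`, so on `Λₙ` it only sees the
linear part. -/
theorem derivation_apply_of_mem {n : ℕ} {V : Type*} [AddCommGroup V] [Module K V]
    [Module (MvPolynomial (Fin n) K) V]
    (D : Derivation K (MvPolynomial (Fin n) K) V) {f : MvPolynomial (Fin n) K}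
    (hf : f ∈ Lam Fq K n) :
    D f = ∑ i, linPart f (Pi.single i 1) • D (X i) := by
  classical
  induction hf using Submodule.span_induction with
  | mem f hf =>
    obtain ⟨⟨i, j⟩, rfl⟩ := hf
    rcases eq_or_ne j 0 with rfl | hj
    · simp [linPart_X, Pi.single_apply]
    · have h1 := linPart_X_pow Fq (1 : K) i hj
      rw [one_smul] at h1
      have h2 : ((Nat.card Fq ^ j : ℕ) : MvPolynomial (Fin n) K) = 0 := by
        rw [← map_natCast (C : K →+* MvPolynomial (Fin n) K), Nat.cast_pow,
          card_cast_eq_zero Fq K, zero_pow hj, map_zero]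
      simp only [h1, Derivation.leibniz_pow, LinearMap.zero_apply, zero_smul,
        Finset.sum_const_zero]
      rw [← Nat.cast_smul_eq_nsmul (MvPolynomial (Fin n) K), h2, zero_smul]
  | zero => simp [linPart_zero]
  | add f g _ _ hf hg => simp [linPart_add, hf, hg, add_smul, Finset.sum_add_distrib]
  | smul c f _ hf => simp [linPart_smul, hf, mul_smul, Finset.smul_sum]

/-- The étale criterion behind `finite_setOf_eval_eq_zero`: the relations `hᵢ = Xᵢ + ⋯`, whose
other terms have zero derivative, force all the differentials `dXᵢ` to vanish. -/
theorem formallyUnramified_of_linPart_eq {n : ℕ} {S : Type*} [CommRing S] [Algebra K S]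
    [Algebra (MvPolynomial (Fin n) K) S] [IsScalarTower K (MvPolynomial (Fin n) K) S]
    (hS : Function.Surjective (algebraMap (MvPolynomial (Fin n) K) S)) (h : Fin n → Lam Fq K n)
    (hh : ∀ i, linPart (h i : MvPolynomial (Fin n) K) = LinearMap.proj i)
    (h0 : ∀ i, algebraMap (MvPolynomial (Fin n) K) S (h i) = 0) :
    Algebra.FormallyUnramified K S := by
  classical
  set D := (KaehlerDifferential.D K S).compAlgebraMap (MvPolynomial (Fin n) K) with hDdef
  have hDa : ∀ p, D p = KaehlerDifferential.D K S (algebraMap _ S p) := fun _ => rfl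
  have hX : ∀ i, D (X i) = 0 := by
    intro i
    have h1 := derivation_apply_of_mem D (h i).2
    rw [hDa, h0, map_zero] at h1
    simpa [hh, Pi.single_apply] using h1.symm
  have hD0 : D = 0 := MvPolynomial.derivation_ext (by simpa using hX)
  have hD : KaehlerDifferential.D K S = 0 := by
    ext x
    obtain ⟨p, rfl⟩ := hS x
    rw [← hDa, hD0]; rfl
  rw [Algebra.formallyUnramified_iff]
  have h1 := KaehlerDifferential.span_range_derivation K S
  have h2 : Submodule.span S (Set.range (KaehlerDifferential.D K S)) = ⊥ := by
    rw [Submodule.span_eq_bot]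
    rintro _ ⟨x, rfl⟩
    rw [hD]; rfl
  rw [h2] at h1
  exact (Submodule.subsingleton_iff S).1 (subsingleton_of_bot_eq_top h1)

/-- A system of `n` additive equations in `n` unknowns with linear part the identity has finitely
many solutions: they are the `K`-points of a finite `K`-algebra. -/
theorem finite_setOf_eval_eq_zero {n : ℕ} (h : Fin n → Lam Fq K n)
    (hh : ∀ i, linPart (h i : MvPolynomial (Fin n) K) = LinearMap.proj i) :
    {x : Fin n → K | ∀ i, eval x (h i : MvPolynomial (Fin n) K) = 0}.Finite := by
  classical
  set I : Ideal (MvPolynomial (Fin n) K) :=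
    Ideal.span (Set.range fun i => (h i : MvPolynomial (Fin n) K)) with hI
  have := formallyUnramified_of_linPart_eq (S := MvPolynomial (Fin n) K ⧸ I)
    Ideal.Quotient.mk_surjective h hh
    fun i => Ideal.Quotient.eq_zero_iff_mem.2 (Ideal.subset_span ⟨i, rfl⟩)
  have hfin : Module.Finite K (MvPolynomial (Fin n) K ⧸ I) :=
    Algebra.FormallyUnramified.finite_of_free K _
  have hle : ∀ x : {x : Fin n → K | ∀ i, eval x (h i : MvPolynomial (Fin n) K) = 0},
      ∀ a ∈ I, aeval x.1 a = 0 := by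
    intro x a ha
    have : I ≤ RingHom.ker (aeval (R := K) x.1) := by
      rw [hI, Ideal.span_le]
      rintro _ ⟨i, rfl⟩
      simpa [aeval_eq_eval] using x.2 i
    exact this ha
  -- solutions are algebra homomorphisms from the quotient to `K`
  refine Set.finite_coe_iff.1 (Finite.of_injective (β := (MvPolynomial (Fin n) K ⧸ I) →ₐ[K] K)
    (fun x => Ideal.Quotient.liftₐ I (aeval x.1) (hle x)) fun x y hxy => ?_)
  ext i
  have := DFunLike.congr_fun hxy (Ideal.Quotient.mk I (X i))
  simpa using this

end Etale

/-! ### The twisted polynomial ring and its module `K` -/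

section TwistedPolynomials

open Polynomial

variable (Fq : Type*) [Field Fq] [Finite Fq] {K : Type*} [Field K] [Algebra Fq K]

variable (K) in
/-- The `q ^ j`-power map of `K`, where `q = #Fq`. -/
noncomputable def powHom (j : ℕ) : K →ₐ[Fq] K := (exists_powHom Fq K j).choose

theorem powHom_apply (j : ℕ) (x : K) : powHom Fq K j x = x ^ (Nat.card Fq ^ j) :=
  (exists_powHom Fq K j).choose_spec x

/-- The `Fq`-linear map `x ↦ ∑ aⱼ x ^ (q ^ j)` attached to `p = ∑ aⱼ Tʲ`. It is `K`-linear in `p`,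
but composition does not correspond to the commutative product of polynomials: see
`skewEval_monomial_mul`. -/
noncomputable def skewEval : K[X] →ₗ[K] Module.End Fq K :=
  Polynomial.lsum fun j =>
    LinearMap.toSpanSingleton K (Module.End Fq K) (powHom Fq K j).toLinearMap

theorem skewEval_monomial (j : ℕ) (a x : K) :
    skewEval Fq (monomial j a) x = a * x ^ (Nat.card Fq ^ j) := by
  simp [skewEval, powHom_apply, Polynomial.lsum]

/-- The commutation rule `τʲ b = b ^ (q ^ j) τʲ`, in terms of ordinary polynomials. -/
theorem skewEval_monomial_mul (j : ℕ) (a : K) (p : K[X]) :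
    skewEval Fq (monomial j a) * skewEval Fq p =
      skewEval Fq (monomial j a * p.map (powHom Fq K j : K →+* K)) := by
  induction p using Polynomial.induction_on' with
  | add p r hp hr => rw [map_add, mul_add, hp, hr, ← map_add, ← mul_add, Polynomial.map_add]
  | monomial k b =>
    ext x
    simp [skewEval_monomial, map_monomial, monomial_mul_monomial, powHom_apply, mul_pow, pow_add,
      pow_mul, mul_assoc, pow_right_comm]

variable (K) in
/-- The maps `x ↦ ∑ aⱼ x ^ (q ^ j)` of `K` to itself, as a subalgebra of `End(K)`. -/
noncomputable def skewSubalgebra : Subalgebra Fq (Module.End Fq K) where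
  carrier := Set.range (skewEval Fq)
  mul_mem' := by
    rintro _ _ ⟨p, rfl⟩ ⟨r, rfl⟩
    induction p using Polynomial.induction_on' with
    | add p s hp hs =>
      obtain ⟨t, ht⟩ := hp
      obtain ⟨u, hu⟩ := hs
      exact ⟨t + u, by rw [map_add, map_add, add_mul, ht, hu]⟩
    | monomial j a => exact ⟨_, (skewEval_monomial_mul Fq j a r).symm⟩
  add_mem' := by
    rintro _ _ ⟨p, rfl⟩ ⟨r, rfl⟩
    exact ⟨p + r, map_add _ _ _⟩
  algebraMap_mem' c := by
    refine ⟨monomial 0 (algebraMap Fq K c), ?_⟩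
    ext x
    rw [skewEval_monomial, pow_zero, pow_one, Module.algebraMap_end_apply, Algebra.smul_def]

variable (K) in
/-- The twisted polynomial ring `K{τ}`, where `τ` is the `q`-power map, as the ring of the
maps `x ↦ ∑ aⱼ x ^ (q ^ j)` of `K` to itself. -/
def Skew : Type _ := skewSubalgebra Fq K

noncomputable instance : Ring (Skew Fq K) := inferInstanceAs (Ring (skewSubalgebra Fq K))

noncomputable instance : Module (Skew Fq K) K :=
  inferInstanceAs (Module (skewSubalgebra Fq K) K)

/-- The element `∑ aⱼ τʲ` of `K{τ}` attached to `p = ∑ aⱼ Tʲ`. -/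
noncomputable def Skew.mk (p : K[X]) : Skew Fq K := ⟨skewEval Fq p, p, rfl⟩

theorem Skew.mk_surjective : Function.Surjective (Skew.mk Fq (K := K)) := by
  rintro ⟨_, p, rfl⟩
  exact ⟨p, rfl⟩

theorem Skew.mk_smul (p : K[X]) (x : K) : Skew.mk Fq p • x = skewEval Fq p x := rfl

theorem Skew.mk_monomial_smul (j : ℕ) (a x : K) :
    Skew.mk Fq (monomial j a) • x = a * x ^ (Nat.card Fq ^ j) := skewEval_monomial Fq j a x

theorem Skew.mk_zero : Skew.mk Fq (0 : K[X]) = 0 := Subtype.ext (map_zero _)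

theorem Skew.mk_sub (p r : K[X]) : Skew.mk Fq (p - r) = Skew.mk Fq p - Skew.mk Fq r :=
  Subtype.ext (map_sub _ _ _)

theorem Skew.mk_add (p r : K[X]) : Skew.mk Fq (p + r) = Skew.mk Fq p + Skew.mk Fq r :=
  Subtype.ext (map_add _ _ _)

theorem Skew.mk_monomial_mul (j : ℕ) (a : K) (p : K[X]) :
    Skew.mk Fq (monomial j a) * Skew.mk Fq p =
      Skew.mk Fq (monomial j a * p.map (powHom Fq K j : K →+* K)) :=
  Subtype.ext (skewEval_monomial_mul Fq j a p)

/-- Left ideals of `K{τ}` are principal, by right division with remainder. -/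
theorem Skew.eq_bot_or_eq_span (I : Ideal (Skew Fq K)) :
    I = ⊥ ∨ ∃ p : K[X], p ≠ 0 ∧ I = Ideal.span {Skew.mk Fq p} := by
  by_cases hI : ∃ p : K[X], p ≠ 0 ∧ Skew.mk Fq p ∈ I
  · obtain ⟨p, ⟨hp0, hpI⟩, hmin⟩ :=
      WellFounded.has_min (measure (natDegree (R := K))).wf {p | p ≠ 0 ∧ Skew.mk Fq p ∈ I} hI
    refine Or.inr ⟨p, hp0, le_antisymm ?_ ((Ideal.span_singleton_le_iff_mem _).2 hpI)⟩
    have key : ∀ (d : ℕ) (f : K[X]), f.natDegree = d → Skew.mk Fq f ∈ I →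
        Skew.mk Fq f ∈ Ideal.span {Skew.mk Fq p} := by
      intro d
      induction d using Nat.strong_induction_on with
      | _ d ih =>
      intro f hd hf
      rcases eq_or_ne f 0 with rfl | hf0
      · rw [Skew.mk_zero]; exact zero_mem _
      have hle : p.natDegree ≤ f.natDegree := not_lt.1 fun h => hmin f ⟨hf0, hf⟩ h
      -- subtract the left multiple of `p` with the same leading term as `f`
      set k := f.natDegree - p.natDegree with hk
      set P := p.map (powHom Fq K k : K →+* K) with hP
      have hP0 : P ≠ 0 := (Polynomial.map_ne_zero_iff (powHom Fq K k).injective).2 hp0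
      have hPd : P.natDegree = p.natDegree := natDegree_map_eq_of_injective
        (powHom Fq K k).injective p
      set m : K[X] := monomial k (f.leadingCoeff / P.leadingCoeff) with hm
      have hl : P.leadingCoeff ≠ 0 := leadingCoeff_ne_zero.2 hP0
      have hc : f.leadingCoeff / P.leadingCoeff ≠ 0 := div_ne_zero (leadingCoeff_ne_zero.2 hf0) hl
      have hm0 : m ≠ 0 := by rwa [hm, Ne, monomial_eq_zero_iff]
      have hspan : Skew.mk Fq (m * P) ∈ Ideal.span {Skew.mk Fq p} := by
        rw [hm, hP, ← Skew.mk_monomial_mul]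
        exact Ideal.mul_mem_left _ _ (Ideal.mem_span_singleton_self _)
      have hmem : Skew.mk Fq (f - m * P) ∈ I := by
        rw [Skew.mk_sub]
        exact sub_mem hf ((Ideal.span_singleton_le_iff_mem _).2 hpI hspan)
      classical
      have hdeg : f.degree = (m * P).degree := by
        rw [degree_eq_natDegree hf0, degree_eq_natDegree (mul_ne_zero hm0 hP0),
          natDegree_mul hm0 hP0, hPd, hm, natDegree_monomial, if_neg hc, hk,
          Nat.sub_add_cancel hle]
      have hlead : f.leadingCoeff = (m * P).leadingCoeff := by
        rw [leadingCoeff_mul, hm, leadingCoeff_monomial, div_mul_cancel₀ _ hl]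
      have hlt := degree_sub_lt_left hdeg hf0 hlead
      have hres : Skew.mk Fq (f - m * P) ∈ Ideal.span {Skew.mk Fq p} := by
        rcases eq_or_ne (f - m * P) 0 with h0 | h0
        · rw [h0, Skew.mk_zero]; exact zero_mem _
        · exact ih _ (hd ▸ natDegree_lt_natDegree h0 hlt) _ rfl hmem
      have : Skew.mk Fq f = Skew.mk Fq (f - m * P) + Skew.mk Fq (m * P) := by
        rw [← Skew.mk_add, sub_add_cancel]
      rw [this]
      exact add_mem hres hspan
    intro f hf
    obtain ⟨p, rfl⟩ := Skew.mk_surjective Fq f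
    exact key _ p rfl hf
  · push Not at hI
    refine Or.inl (eq_bot_iff.2 fun f hf => ?_)
    obtain ⟨p, rfl⟩ := Skew.mk_surjective Fq f
    rcases eq_or_ne p 0 with rfl | hp
    · rw [Skew.mk_zero]; exact zero_mem _
    · exact absurd hf (hI p hp)

instance : IsPrincipalIdealRing (Skew Fq K) where
  principal I := by
    rcases Skew.eq_bot_or_eq_span Fq I with rfl | ⟨p, -, rfl⟩
    · infer_instance
    · exact ⟨⟨_, rfl⟩⟩

/-- Over an algebraically closed field a nonzero additive polynomial is surjective. -/
theorem exists_skewEval_eq [IsAlgClosed K] {p : K[X]} (hp : p ≠ 0) (y : K) :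
    ∃ x, skewEval Fq p x = y := by
  -- the additive polynomial `∑ aⱼ X ^ (q ^ j)` in one variable
  set f : K[X] := p.sum fun j a => monomial (Nat.card Fq ^ j) a with hf
  have hev : ∀ x, f.eval x = skewEval Fq p x := by
    intro x
    conv_rhs => rw [← p.sum_monomial_eq]
    simp [hf, Polynomial.sum, eval_finsetSum, skewEval_monomial]
  have hinj : Function.Injective fun j : ℕ => Nat.card Fq ^ j :=
    Nat.pow_right_injective (Finite.one_lt_card (α := Fq))
  have hcoeff : f.coeff (Nat.card Fq ^ p.natDegree) = p.leadingCoeff := by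
    rw [hf, Polynomial.sum, finsetSum_coeff, Finset.sum_eq_single p.natDegree]
    · simp
    · intro j _ hj
      exact coeff_monomial_of_ne _ fun h => hj (hinj h).symm
    · intro h
      simp [notMem_support_iff.1 h]
  have hpos : 0 < f.natDegree :=
    lt_of_lt_of_le (pow_pos (Finite.card_pos (α := Fq)) _)
      (le_natDegree_of_ne_zero (by rw [hcoeff]; exact leadingCoeff_ne_zero.2 hp))
  have hd : (f - C y).degree ≠ 0 := by
    rw [degree_eq_natDegree (fun h => by rw [sub_eq_zero.1 h, natDegree_C] at hpos; omega),
      natDegree_sub_C]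
    exact_mod_cast hpos.ne'
  obtain ⟨x, hx⟩ := IsAlgClosed.exists_root _ hd
  refine ⟨x, ?_⟩
  rw [← hev]
  simpa [sub_eq_zero] using hx

/-- `K` is an injective `K{τ}`-module: left ideals are principal and `K` is divisible. -/
theorem baer_skew [IsAlgClosed K] : Module.Baer (Skew Fq K) K := by
  intro I g
  rcases Skew.eq_bot_or_eq_span Fq I with rfl | ⟨p, hp, rfl⟩
  · refine ⟨0, fun x hx => ?_⟩
    obtain rfl : x = 0 := hx
    exact (map_zero g).symm
  · obtain ⟨x, hx⟩ := exists_skewEval_eq Fq hp (g ⟨_, Ideal.mem_span_singleton_self _⟩)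
    refine ⟨LinearMap.toSpanSingleton (Skew Fq K) K x, fun f hf => ?_⟩
    obtain ⟨r, rfl⟩ := Ideal.mem_span_singleton'.1 hf
    have : (⟨r * Skew.mk Fq p, hf⟩ : Ideal.span {Skew.mk Fq p}) =
        r • ⟨Skew.mk Fq p, Ideal.mem_span_singleton_self _⟩ := rfl
    rw [this, map_smul, ← hx, LinearMap.toSpanSingleton_apply, mul_smul, Skew.mk_smul]

end TwistedPolynomials

/-! ### Linear parts -/

section Functions

open MvPolynomial

variable {Fq : Type*} [Field Fq] [Finite Fq] {K : Type*} [Field K] [Algebra Fq K]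

variable (Fq K) in
/-- Taking the linear part, as a linear map from `Λₙ` to the dual of `Kⁿ`. -/
noncomputable def linPartHom (n : ℕ) : Lam Fq K n →ₗ[K] Module.Dual K (Fin n → K) where
  toFun f := linPart (f : MvPolynomial (Fin n) K)
  map_add' _ _ := linPart_add _ _
  map_smul' _ _ := linPart_smul _ _

/-- `M F`, as a `K`-subspace of `Λₙ`. -/
def vanishing {n : ℕ} (F : Submodule Fq (Fin n → K)) : Submodule K (Lam Fq K n) where
  carrier := M F
  zero_mem' x _ := by simp
  add_mem' {f g} hf hg x hx := by simp [hf x hx, hg x hx]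
  smul_mem' c f hf x hx := by simp [hf x hx]

/-- A linear part that vanishes on the tangent space is the linear part of an element of `M F`:
a subspace of the dual of `Kⁿ` is the annihilator of its common kernel. -/
theorem exists_mem_M_linPart_eq {n : ℕ} {F : Submodule Fq (Fin n → K)}
    (l : Module.Dual K (Fin n → K)) (hl : ∀ x ∈ T F, l x = 0) :
    ∃ m ∈ M F, linPart (m : MvPolynomial (Fin n) K) = l := by
  have h1 := Subspace.dualCoannihilator_dualAnnihilator_eq
    (W := (vanishing F).map (linPartHom Fq K n))
  have h2 : l ∈ (vanishing F).map (linPartHom Fq K n) := by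
    rw [← h1, Submodule.mem_dualAnnihilator]
    intro x hx
    refine hl x (mem_T.2 fun f hf => ?_)
    exact (Submodule.mem_dualCoannihilator _).1 hx _ ⟨f, hf, rfl⟩
  obtain ⟨m, hm, rfl⟩ := h2
  exact ⟨m, hm, rfl⟩

/-- `Λₙ = ⨁ K Xᵢ ⊕ τ Λₙ`; this uses that `K` is perfect. -/
theorem exists_eq_linear_add_pow [IsAlgClosed K] {n : ℕ} {f : MvPolynomial (Fin n) K}
    (hf : f ∈ Lam Fq K n) : ∃ h ∈ Lam Fq K n,
      f = ∑ i, linPart f (Pi.single i 1) • X i + h ^ Nat.card Fq := by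
  classical
  obtain ⟨φ, hφ⟩ := exists_powHom Fq (MvPolynomial (Fin n) K) 1
  simp only [pow_one] at hφ
  induction hf using Submodule.span_induction with
  | mem f hf =>
    obtain ⟨⟨i, j⟩, rfl⟩ := hf
    rcases j with - | j
    · refine ⟨0, zero_mem _, ?_⟩
      rw [zero_pow (Finite.card_pos (α := Fq)).ne']
      simp [linPart_X, Pi.single_apply]
    · refine ⟨_, Submodule.subset_span ⟨(i, j), rfl⟩, ?_⟩
      have h1 := linPart_X_pow Fq (1 : K) i j.succ_ne_zero
      rw [one_smul] at h1
      simp only [h1, ← pow_mul, ← pow_succ, LinearMap.zero_apply, zero_smul,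
        Finset.sum_const_zero, zero_add]
  | zero =>
    refine ⟨0, zero_mem _, ?_⟩
    rw [zero_pow (Finite.card_pos (α := Fq)).ne']
    simp [linPart_zero]
  | add f g _ _ hf hg =>
    obtain ⟨u, hu, hf⟩ := hf
    obtain ⟨v, hv, hg⟩ := hg
    refine ⟨u + v, add_mem hu hv, ?_⟩
    conv_lhs => rw [hf, hg]
    rw [← hφ, ← hφ, ← hφ, map_add, linPart_add]
    simp only [LinearMap.add_apply, add_smul, Finset.sum_add_distrib]
    abel
  | smul c f _ hf =>
    obtain ⟨u, hu, hf⟩ := hf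
    obtain ⟨b, rfl⟩ := IsAlgClosed.exists_pow_nat_eq c (Finite.card_pos (α := Fq))
    refine ⟨b • u, Submodule.smul_mem _ _ hu, ?_⟩
    conv_lhs => rw [hf]
    simp [linPart_smul, smul_pow, Finset.smul_sum, mul_smul]

/-- Over a perfect field, an element of `Λₙ` without linear part is left divisible by `τ`. -/
theorem exists_eq_pow_of_linPart_eq_zero [IsAlgClosed K] {n : ℕ} {f : MvPolynomial (Fin n) K}
    (hf : f ∈ Lam Fq K n) (h0 : linPart f = 0) : ∃ h ∈ Lam Fq K n, f = h ^ Nat.card Fq := by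
  obtain ⟨h, hh, hfh⟩ := exists_eq_linear_add_pow hf
  exact ⟨h, hh, by simpa [h0] using hfh⟩

/-! ### The module of functions on a `q`-variety -/

theorem exists_eval_eq_skew_smul {n : ℕ} (r : Skew Fq K) (f : Lam Fq K n) :
    ∃ g : Lam Fq K n, ∀ x, eval x (g : MvPolynomial (Fin n) K) =
      r • eval x (f : MvPolynomial (Fin n) K) := by
  obtain ⟨p, rfl⟩ := Skew.mk_surjective Fq r
  induction p using Polynomial.induction_on' with
  | add p s hp hs =>
    obtain ⟨g, hg⟩ := hp
    obtain ⟨h, hh⟩ := hs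
    exact ⟨g + h, fun x => by simp [Skew.mk_add, add_smul, hg, hh]⟩
  | monomial j a =>
    exact ⟨a • ⟨_, (pow_mem f.2 j).1⟩, fun x => by simp [Skew.mk_monomial_smul]⟩

/-- The left `K{τ}`-module `Mor(F, K) = Λₙ / M F` of the restrictions to `F` of the elements of
`Λₙ`, realized inside the functions `F → K` as the submodule generated by the coordinates. -/
noncomputable def coordModule {n : ℕ} (F : Submodule Fq (Fin n → K)) :
    Submodule (Skew Fq K) (F → K) :=
  Submodule.span (Skew Fq K) (Set.range fun i x => (x : Fin n → K) i)

theorem eval_mem_coordModule {n : ℕ} (F : Submodule Fq (Fin n → K))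
    {f : MvPolynomial (Fin n) K} (hf : f ∈ Lam Fq K n) :
    (fun x : F => eval (x : Fin n → K) f) ∈ coordModule F := by
  induction hf using Submodule.span_induction with
  | mem f hf =>
    obtain ⟨⟨i, j⟩, rfl⟩ := hf
    convert Submodule.smul_mem (coordModule F) (Skew.mk Fq (Polynomial.monomial j (1 : K)))
      (Submodule.subset_span (Set.mem_range_self i)) using 1
    ext x
    rw [Pi.smul_apply, Skew.mk_monomial_smul]
    simp
  | zero =>
    simp only [map_zero]
    exact zero_mem (coordModule F)
  | add f g _ _ hf hg =>
    simp only [map_add]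
    exact add_mem hf hg
  | smul c f _ hf =>
    convert Submodule.smul_mem (coordModule F) (Skew.mk Fq (Polynomial.monomial 0 c)) hf using 1
    ext x
    rw [Pi.smul_apply, Skew.mk_monomial_smul]
    simp

theorem mem_coordModule {n : ℕ} {F : Submodule Fq (Fin n → K)} {φ : F → K} :
    φ ∈ coordModule F ↔
      ∃ f : Lam Fq K n, ∀ x : F, φ x = eval (x : Fin n → K) (f : MvPolynomial (Fin n) K) := by
  refine ⟨fun h => ?_, fun ⟨f, hf⟩ => (funext hf : φ = _) ▸ eval_mem_coordModule F f.2⟩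
  induction h using Submodule.span_induction with
  | mem φ h =>
    obtain ⟨i, rfl⟩ := h
    exact ⟨⟨X i, Submodule.subset_span ⟨(i, 0), by simp⟩⟩, fun x => by simp⟩
  | zero => exact ⟨0, fun x => by simp⟩
  | add φ χ _ _ hφ hχ =>
    obtain ⟨f, hf⟩ := hφ
    obtain ⟨g, hg⟩ := hχ
    exact ⟨f + g, fun x => by simp [hf, hg]⟩
  | smul r φ _ hφ =>
    obtain ⟨f, hf⟩ := hφ
    obtain ⟨g, hg⟩ := exists_eval_eq_skew_smul r f
    exact ⟨g, fun x => by rw [hg, ← hf, Pi.smul_apply]⟩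

/-- A `K{τ}`-linear form on `Mor(F, K)` is the evaluation at the point of `Kⁿ` whose coordinates
are its values at the coordinate functions. -/
theorem apply_eval_coordModule {n : ℕ} {F : Submodule Fq (Fin n → K)}
    (ρ : coordModule F →ₗ[Skew Fq K] K) {f : MvPolynomial (Fin n) K} (hf : f ∈ Lam Fq K n) :
    ρ ⟨_, eval_mem_coordModule F hf⟩ =
      eval (fun i => ρ ⟨_, Submodule.subset_span (Set.mem_range_self i)⟩) f := by
  induction hf using Submodule.span_induction with
  | mem f hf =>
    obtain ⟨⟨i, j⟩, rfl⟩ := hf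
    have : ∀ h, (⟨fun x : F => eval (x : Fin n → K) (X i ^ (Nat.card Fq ^ j)), h⟩ :
        coordModule F) = Skew.mk Fq (Polynomial.monomial j (1 : K)) •
          ⟨_, Submodule.subset_span (Set.mem_range_self i)⟩ := by
      intro h
      ext x
      rw [Submodule.coe_smul, Pi.smul_apply, Skew.mk_monomial_smul]
      simp
    rw [this, map_smul, Skew.mk_monomial_smul]
    simp
  | zero =>
    rw [map_zero, ← map_zero ρ]
    congr 1
  | add f g hf hg hf' hg' =>
    rw [map_add, ← hf', ← hg', ← map_add]
    congr 1
    ext x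
    simp
  | smul c f hf hf' =>
    have : c * eval (fun i => ρ ⟨_, Submodule.subset_span (Set.mem_range_self i)⟩) f =
        Skew.mk Fq (Polynomial.monomial 0 c) •
          eval (fun i => ρ ⟨_, Submodule.subset_span (Set.mem_range_self i)⟩) f := by
      rw [Skew.mk_monomial_smul, pow_zero, pow_one]
    rw [smul_eval, this, ← hf', ← map_smul]
    congr 1
    ext x
    rw [Submodule.coe_smul, Pi.smul_apply, Skew.mk_monomial_smul]
    simp

theorem IsQVariety.mem_iff {n : ℕ} {F : Submodule Fq (Fin n → K)} (hF : IsQVariety F)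
    {x : Fin n → K} : x ∈ F ↔ ∀ f ∈ M F, eval x (f : MvPolynomial (Fin n) K) = 0 := by
  refine ⟨fun hx f hf => hf x hx, fun h => ?_⟩
  obtain ⟨S, rfl⟩ := hF
  exact fun f hf => h f fun y hy => hy f hf

/-! ### Endomorphisms with scalar differential -/

/-- A morphism whose differential is multiplication by some `c ≠ 0` has finite kernel. -/
theorem finite_ker_of_linPart_eq_smul {n : ℕ} {F : Submodule Fq (Fin n → K)} {ψ : F → F}
    {f : Fin n → Lam Fq K n} (hf : Represents f ψ) {c : K} (hc : c ≠ 0)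
    (hd : ∀ x ∈ T F, ∀ i, linPart (f i : MvPolynomial (Fin n) K) x = c * x i) :
    {x : F | ψ x = 0}.Finite := by
  -- correcting `fᵢ` by an element of `M F` makes its linear part `c Xᵢ` on all of `Kⁿ`
  choose m hm hm' using fun i => exists_mem_M_linPart_eq (F := F)
    (linPart (f i : MvPolynomial (Fin n) K) - c • LinearMap.proj i)
    fun x hx => by simp [hd x hx i]
  have hlin : ∀ i, linPart ((c⁻¹ • (f i - m i) : Lam Fq K n) : MvPolynomial (Fin n) K) =
      LinearMap.proj i := by
    intro i
    have h1 : linPartHom Fq K n (m i) = linPartHom Fq K n (f i) - c • LinearMap.proj i := hm' i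
    have h2 : linPartHom Fq K n (c⁻¹ • (f i - m i)) = LinearMap.proj i := by
      rw [map_smul, map_sub, h1, sub_sub_cancel, smul_smul, inv_mul_cancel₀ hc, one_smul]
    exact h2
  have hfin := finite_setOf_eval_eq_zero _ hlin
  refine (hfin.preimage Subtype.val_injective.injOn).subset fun x hx => ?_
  rw [Set.mem_preimage, Set.mem_ofPred_eq]
  intro i
  have h1 := hf x i
  rw [show ψ x = 0 from hx] at h1
  simp [← h1, hm i x x.2]

/-- If the differential of `ψ` is multiplication by some `c ≠ 0`, then a function on `F` killed by
the pullback `ψ^*` is the `q`-th power of another such function. -/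
theorem exists_eq_pow_of_comp_eq_zero [IsAlgClosed K] {n : ℕ} {F : Submodule Fq (Fin n → K)}
    {ψ : F → F} {f : Fin n → Lam Fq K n} (hf : Represents f ψ) {c : K} (hc : c ≠ 0)
    (hd : ∀ x ∈ T F, ∀ i, linPart (f i : MvPolynomial (Fin n) K) x = c * x i)
    {φ : F → K} (hφ : φ ∈ coordModule F) (h0 : ∀ x, φ (ψ x) = 0) :
    ∃ χ ∈ coordModule F, (∀ x, χ (ψ x) = 0) ∧ ∀ x, φ x = χ x ^ Nat.card Fq := by
  obtain ⟨g, hg⟩ := mem_coordModule.1 hφ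
  have hlin : ∀ x ∈ T F, linPart (g : MvPolynomial (Fin n) K) x = 0 := by
    intro x hx
    have h1 := mem_T.1 hx ⟨_, (bind_mem g.2 f).1⟩ fun y hy => by
      have h2 := h0 ⟨y, hy⟩
      rw [hg] at h2
      rw [eval_bind, ← h2]
      congr 2
      ext i
      rw [hf]
    rw [(bind_mem g.2 f).2 x] at h1
    have h3 : (fun i => linPart (f i : MvPolynomial (Fin n) K) x) = c • x := by
      ext i
      simp [hd x hx i]
    rw [h3, map_smul, smul_eq_mul] at h1
    exact (mul_eq_zero.1 h1).resolve_left hc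
  obtain ⟨m, hm, hml⟩ := exists_mem_M_linPart_eq _ hlin
  have h4 : linPartHom Fq K n (g - m) = 0 := by
    rw [map_sub, sub_eq_zero]
    exact hml.symm
  obtain ⟨h, hh, hgh⟩ := exists_eq_pow_of_linPart_eq_zero (g - m).2 h4
  -- on `F` both `g` and `g - m = h ^ q` induce `φ`
  have hpow : ∀ x : F, φ x = eval (x : Fin n → K) h ^ Nat.card Fq := by
    intro x
    have h5 := congrArg (eval (x : Fin n → K)) hgh
    rw [map_pow, AddSubgroupClass.coe_sub, map_sub, hm x x.2, sub_zero] at h5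
    rw [hg, h5]
  refine ⟨_, eval_mem_coordModule F hh, fun x => ?_, hpow⟩
  have := hpow (ψ x)
  rw [h0] at this
  exact (pow_eq_zero_iff (Finite.card_pos (α := Fq)).ne').1 this.symm

instance {n : ℕ} (F : Submodule Fq (Fin n → K)) : IsNoetherian (Skew Fq K) (coordModule F) :=
  isNoetherian_span_of_finite _ (Set.finite_range _)

/-- On an irreducible `q`-variety, a submodule `L` of `Mor(F, K)` with `L = τ L` is zero. Indeed `L`
is finitely generated, and its generators satisfy a system `sᵢ = ∑ rᵢⱼ(sⱼ)` with `rᵢⱼ ∈ τ K{τ}`;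
thus they take only finitely many values on `F`, and the zero set of `L` has finite index. -/
theorem eq_zero_of_forall_exists_pow {n : ℕ} {F : Submodule Fq (Fin n → K)}
    (hF : IsQVariety F) (hirr : IsIrreducible F) {L : Submodule (Skew Fq K) (F → K)}
    (hL : L ≤ coordModule F)
    (hpow : ∀ φ ∈ L, ∃ χ ∈ L, ∀ x, φ x = χ x ^ Nat.card Fq) {φ : F → K} (hφ : φ ∈ L) :
    φ = 0 := by
  obtain ⟨m, s, hs⟩ := Submodule.fg_iff_exists_fin_generating_family.1
    (isNoetherian_submodule.1 (inferInstance : IsNoetherian (Skew Fq K) (coordModule F)) L hL)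
  have hsL : ∀ i, s i ∈ L := fun i => hs ▸ Submodule.subset_span (Set.mem_range_self i)
  choose χ hχ hsχ using fun i => hpow (s i) (hsL i)
  have hχ' : ∀ i, ∃ r : Fin m → Skew Fq K, ∑ j, r j • s j = χ i := fun i => by
    have := hχ i
    rwa [← hs, Submodule.mem_span_range_iff_exists_fun] at this
  choose r hr using hχ'
  have hXmem : ∀ i, (X i : MvPolynomial (Fin m) K) ∈ Lam Fq K m := fun i =>
    Submodule.subset_span ⟨(i, 0), by simp⟩
  choose g hg using fun i j => exists_eval_eq_skew_smul (r i j) ⟨X j, hXmem j⟩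
  -- `uᵢ = (∑ⱼ rᵢⱼ(Xⱼ)) ^ q`, so that the generators satisfy `sᵢ = uᵢ(s)`
  let u : Fin m → Lam Fq K m := fun i => ⟨_, (pow_mem (∑ j, g i j).2 1).1⟩
  have hu : ∀ i, linPart (u i : MvPolynomial (Fin m) K) = 0 := fun i =>
    (pow_mem (∑ j, g i j).2 1).2 one_ne_zero
  have hfin := finite_setOf_eval_eq_zero (fun i => (⟨X i, hXmem i⟩ - u i : Lam Fq K m)) (by
    intro i
    have h1 : linPartHom Fq K m (⟨X i, hXmem i⟩ - u i) = LinearMap.proj i := by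
      rw [map_sub, show linPartHom Fq K m (u i) = 0 from hu i, sub_zero]
      exact LinearMap.ext fun x => linPart_X i x
    exact h1)
  have hmem : ∀ x : F, (fun i => s i x) ∈ {y : Fin m → K | ∀ i,
      eval y ((⟨X i, hXmem i⟩ - u i : Lam Fq K m) : MvPolynomial (Fin m) K) = 0} := by
    intro x i
    simp [u, hg, hsχ i x, ← hr i, sub_self]
  have hadd : ∀ φ ∈ L, ∀ x y, φ (x - y) = φ x - φ y := by
    intro φ hφ x y
    obtain ⟨f, hf⟩ := mem_coordModule.1 (hL hφ)
    rw [eq_sub_iff_add_eq, hf, hf, hf, ← eval_add_of_mem f.2]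
    congr 2
    exact sub_add_cancel (x : Fin n → K) y
  -- the zero set of `L`
  set H : Submodule Fq (Fin n → K) := Z {f : Lam Fq K n |
    (fun x : F => eval (x : Fin n → K) (f : MvPolynomial (Fin n) K)) ∈ L} with hH
  have hHF : H ≤ F := by
    intro x hx
    refine hF.mem_iff.2 fun f hf => hx f ?_
    have : (fun x : F => eval (x : Fin n → K) (f : MvPolynomial (Fin n) K)) = 0 :=
      funext fun x => hf x x.2
    rw [Set.mem_ofPred_eq, this]
    exact zero_mem L
  have hHmem : ∀ x : F, (∀ i, s i x = 0) → (x : Fin n → K) ∈ H := by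
    intro x hx f hf
    rw [Set.mem_ofPred_eq, ← hs, Submodule.mem_span_range_iff_exists_fun] at hf
    obtain ⟨c, hc⟩ := hf
    have := congrFun hc x
    simpa [hx] using this.symm
  have hquot : Finite (F ⧸ H.submoduleOf F) := by
    have := hfin.to_subtype
    refine Finite.of_injective (fun a : F ⧸ H.submoduleOf F =>
      (⟨_, hmem (Quotient.out a)⟩ : {y : Fin m → K | ∀ i,
        eval y ((⟨X i, hXmem i⟩ - u i : Lam Fq K m) : MvPolynomial (Fin m) K) = 0})) ?_
    intro a b hab
    have h1 : ∀ i, s i a.out = s i b.out := fun i => congrFun (congrArg Subtype.val hab) i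
    have h2 := hHmem (a.out - b.out) fun i => by rw [hadd _ (hsL i), h1, sub_self]
    rw [← Quotient.out_eq a, ← Quotient.out_eq b]
    exact (Submodule.Quotient.eq _).2 h2
  have hHeq := hirr H ⟨_, rfl⟩ hHF hquot
  obtain ⟨f, hf⟩ := mem_coordModule.1 (hL hφ)
  rw [funext hf] at hφ ⊢
  ext x
  have hx : (x : Fin n → K) ∈ H := by rw [hHeq]; exact x.2
  exact hx f hφ

/-- An endomorphism of an irreducible `q`-variety whose differential is multiplication by some
`c ≠ 0` is surjective. -/
theorem surjective_of_linPart_eq_smul [IsAlgClosed K] {n : ℕ} {F : Submodule Fq (Fin n → K)}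
    (hF : IsQVariety F) (hirr : IsIrreducible F) {ψ : F → F}
    {f : Fin n → Lam Fq K n} (hf : Represents f ψ) {c : K} (hc : c ≠ 0)
    (hd : ∀ x ∈ T F, ∀ i, linPart (f i : MvPolynomial (Fin n) K) x = c * x i) :
    Function.Surjective ψ := by
  have hmap : ∀ φ ∈ coordModule F, LinearMap.funLeft (Skew Fq K) K ψ φ ∈ coordModule F := by
    intro φ hφ
    obtain ⟨g, hg⟩ := mem_coordModule.1 hφ
    refine mem_coordModule.2 ⟨⟨_, (bind_mem g.2 f).1⟩, fun x => ?_⟩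
    rw [LinearMap.funLeft_apply, hg, eval_bind]
    congr 2
    ext i
    rw [hf]
  let ψs : coordModule F →ₗ[Skew Fq K] coordModule F :=
    (LinearMap.funLeft (Skew Fq K) K ψ).restrict hmap
  have hinj : Function.Injective ψs := by
    rw [← LinearMap.ker_eq_bot, eq_bot_iff]
    rintro ⟨φ, hφ⟩ h
    have h0 : LinearMap.funLeft (Skew Fq K) K ψ φ = 0 := congrArg Subtype.val h
    refine Subtype.ext (eq_zero_of_forall_exists_pow hF hirr
      (L := coordModule F ⊓ LinearMap.ker (LinearMap.funLeft (Skew Fq K) K ψ))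
      inf_le_left ?_ ⟨hφ, h0⟩)
    rintro φ ⟨hφ, h0⟩
    obtain ⟨χ, hχ, hχ0, hp⟩ := exists_eq_pow_of_comp_eq_zero hf hc hd hφ (congrFun h0)
    exact ⟨χ, ⟨hχ, funext hχ0⟩, hp⟩
  intro y
  -- extend the evaluation at `y` along `ψ^*`; the extension is the evaluation at a preimage
  obtain ⟨ρ, hρ⟩ := (baer_skew Fq).extension_property ψs hinj
    ((LinearMap.proj y).comp (coordModule F).subtype)
  have hx : (fun i => ρ ⟨_, Submodule.subset_span (Set.mem_range_self i)⟩) ∈ F := by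
    refine hF.mem_iff.2 fun g hg => ?_
    rw [← apply_eval_coordModule ρ g.2, ← map_zero ρ]
    congr 1
    ext x
    exact hg x x.2
  refine ⟨⟨_, hx⟩, ?_⟩
  ext i
  rw [hf, ← apply_eval_coordModule ρ (f i).2]
  have h1 := LinearMap.congr_fun hρ ⟨_, Submodule.subset_span (Set.mem_range_self i)⟩
  rw [LinearMap.comp_apply] at h1
  refine Eq.trans ?_ h1
  congr 1
  ext x
  exact (hf x i).symm

end Functions

end QVar

theorem theorem7p5 {Fq K : Type*} [Field Fq] [Finite Fq] [Field K] [IsAlgClosed K] [Algebra Fq K]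
    (δ : Polynomial Fq →ₐ[Fq] K) {N : ℕ} (F : Submodule Fq (Fin N → K))
    (hF : QVar.IsQVariety F) (hirr : QVar.IsIrreducible F) (Φ : QVar.AModule δ F)
    (π : Polynomial Fq) (hπ : Prime π) (hδ : π ∉ RingHom.ker δ) :
    ∃ r : ℕ, ∀ n : ℕ, 0 < n →
      Nonempty (Φ.Tor (π ^ n) ≃ₗ[Polynomial Fq]
        (Fin r → Polynomial Fq ⧸ Ideal.span {π ^ n})) := by
  have hc : δ π ≠ 0 := hδ
  obtain ⟨f, hf⟩ := (Φ.hom π).2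
  have hd : ∀ x ∈ QVar.T F, ∀ i, QVar.linPart (f i : MvPolynomial (Fin N) K) x = δ π * x i := by
    intro x hx i
    rw [← QVar.differential_apply (Φ.hom π).2 hf ⟨x, hx⟩ i, Φ.differential_hom]
    rfl
  have hmax : (Ideal.span {π}).IsMaximal :=
    PrincipalIdealRing.isMaximal_of_irreducible hπ.irreducible
  exact QVar.nonempty_torsionBy_pow_equiv (A := Polynomial Fq) (V := Φ.Carrier)
    (QVar.surjective_of_linPart_eq_smul hF hirr hf hc hd)
    (QVar.finite_ker_of_linPart_eq_smul hf hc hd).to_subtype
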